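/- Let $\mathcal T$ be the type of unlabelled binary trees, with a leaf $0$ and nodes written $\omega^a \oplus b$ for trees $a,b$. Let $<$ be the hereditary lexicographical order on $\mathcal T$, generated by $0<\omega^a\oplus b$; $a<c\Rightarrow \omega^a\oplus b<\omega^c\oplus d$; and $b<d\Rightarrow\omega^a\oplus b<\omega^a\oplus d$; let $s\le t$ mean $s<t$ or $s=t$. Put $\mathrm{left}(0)=0$ and $\mathrm{left}(\omega^a\oplus b)=a$. A tree is a Cantor normal form if $\mathrm{left}(t)\le s$ for every subtree $\omega^s\oplus t$ that it contains; $\mathsf{Cnf}$ is the set of Cantor normal forms. On $\mathsf{Cnf}$, addition, multiplication and exponentiation with base $\omega$ are defined by $0+b=b$; $a+0=a$; $(\omega^a\oplus c)+(\omega^b\oplus d)=\omega^b\oplus d$ if $a<b$, and $=\omega^a\oplus(c+(\omega^b\oplus d))$ otherwise; $0\cdot b=0$; $a\cdot 0=0$; $a\cdot(\omega^0\oplus d)=a+a\cdot d$; $(\omega^a\oplus c)\cdot(\omega^b\oplus d)=(\omega^{a+b}\oplus 0)+(\omega^a\oplus c)\cdot d$ if $b\ne 0$; and $\omega^a=\omega^a\oplus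 0$. Let $\mathsf{Brw}$ be the type of Brouwer trees: the quotient inductive-inductive type, constructed simultaneously with a relation $\le$ on it, with constructors $\mathsf{zero}$; $\mathsf{succ}\,x$; $\mathsf{limit}\,f$ for every sequence $f:\mathbb N\to\mathsf{Brw}$ with $f_k<f_{k+1}$ for all $k$, where $x<y$ means $\mathsf{succ}\,x\le y$; and the identification $\mathsf{limit}\,f=\mathsf{limit}\,g$ whenever $\forall k\,\exists n\; f_k\le g_n$ and $\forall k\,\exists n\; g_k\le f_n$. The relation $\le$ is generated by: $\mathsf{zero}\le x$; transitivity; $x\le y\Rightarrow\mathsf{succ}\,x\le\mathsf{succ}\,y$; $x\le f_k\Rightarrow x\le\mathsf{limit}\,f$; and $(\forall k\; f_k\le x)\Rightarrow\mathsf{limit}\,f\le x$. Addition, multiplication and exponentiation on $\mathsf{Brw}$ are defined by recursion on the second argument: $x+\mathsf{zero}=x$, $x+\mathsf{succ}\,y=\mathsf{succ}(x+y)$, $x+\mathsf{limit}\,f=\mathsf{limit}(\lambda k.\,x+f_k)$; $x\cdot\mathsf{zero}=\mathsf{zero}$, $x\cdot\mathsf{succ}\,y=x\cdot y+x$, $x\cdot\mathsf{limit}\,f=\mathsf{zero}$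 if $x=\mathsf{zero}$ and $=\mathsf{limit}(\lambda k.\,x\cdot f_k)$ otherwise; $x^{\mathsf{zero}}=\mathsf{succ}\,\mathsf{zero}$, $x^{\mathsf{succ}\,y}=x^y\cdot x$, $x^{\mathsf{limit}\,f}=x$ if $x$ is $\mathsf{zero}$ or $\mathsf{succ}\,\mathsf{zero}$, and $=\mathsf{limit}(\lambda k.\,x^{f_k})$ otherwise. Let $\omega\in\mathsf{Brw}$ be the limit of the sequence $\mathsf{zero},\mathsf{succ}\,\mathsf{zero},\mathsf{succ}(\mathsf{succ}\,\mathsf{zero}),\dots$ Define $\mathsf{CtoB}:\mathsf{Cnf}\to\mathsf{Brw}$ by $\mathsf{CtoB}(0)=\mathsf{zero}$ and $\mathsf{CtoB}(\omega^a\oplus b)=\omega^{\mathsf{CtoB}(a)}+\mathsf{CtoB}(b)$. Then for all $a,b\in\mathsf{Cnf}$: 1. $a<b\iff\mathsf{CtoB}(a)<\mathsf{CtoB}(b)$, and $a\le b\iff\mathsf{CtoB}(a)\le\mathsf{CtoB}(b)$; 2. $\mathsf{CtoB}$ is injective; 3. $\mathsf{CtoB}(a+b)=\mathsf{CtoB}(a)+\mathsf{CtoB}(b)$,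 $\mathsf{CtoB}(a\cdot b)=\mathsf{CtoB}(a)\cdot\mathsf{CtoB}(b)$, and $\mathsf{CtoB}(\omega^a)=\omega^{\mathsf{CtoB}(a)}$. -/

import Mathlib

/-! ## Cantor normal forms -/

/-- Unlabelled binary trees; `node a b` is the tree that stands for `ω ^ a + b`. -/
inductive CnfTree : Type
  | zero : CnfTree
  | node : CnfTree → CnfTree → CnfTree

namespace CnfTree

/-- The hereditary lexicographical order on binary trees. -/
inductive Lt : CnfTree → CnfTree → Prop
  | zero_node (a b : CnfTree) : Lt zero (node a b)
  | left {a b c d : CnfTree} : Lt a c → Lt (node a b) (node c d)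
  | right {a b d : CnfTree} : Lt b d → Lt (node a b) (node a d)

/-- `≤` is the reflexive closure of `<`. -/
def Le (s t : CnfTree) : Prop := Lt s t ∨ s = t

/-- The left subtree (if it exists). -/
def left : CnfTree → CnfTree
  | zero => zero
  | node a _ => a

/-- The trees that are Cantor normal forms. -/
inductive IsCNF : CnfTree → Prop
  | zero : IsCNF zero
  | node {s t : CnfTree} : IsCNF s → IsCNF t → Le (left t) s → IsCNF (node s t)

open Classical in
/-- Addition of Cantor normal forms. -/
noncomputable def add : CnfTree → CnfTree → CnfTree
  | zero, b => b
  | node a c, zero => node a c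
  | node a c, node b d => if Lt a b then node b d else node a (add c (node b d))

open Classical in
/-- Multiplication of Cantor normal forms. -/
noncomputable def mul : CnfTree → CnfTree → CnfTree
  | zero, _ => zero
  | node _ _, zero => zero
  | node a c, node b d =>
      if b = zero then add (node a c) (mul (node a c) d)
      else add (node (add a b) zero) (mul (node a c) d)

theorem zero_le (t : CnfTree) : Le zero t := by
  cases t with
  | zero => exact Or.inr rfl
  | node a b => exact Or.inl (Lt.zero_node a b)

theorem le_of_not_lt : ∀ a b : CnfTree, ¬ Lt a b → Le b a
  | _, zero, _ => zero_le _
  | zero, node c d, h => absurd (Lt.zero_node c d) h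
  | node a b, node c d, h => by
      rcases le_of_not_lt a c (fun h' => h (Lt.left h')) with h1 | rfl
      · exact Or.inl (Lt.left h1)
      · rcases le_of_not_lt b d (fun h' => h (Lt.right h')) with h2 | rfl
        · exact Or.inl (Lt.right h2)
        · exact Or.inr rfl

theorem left_add (a b : CnfTree) : left (add a b) = left a ∨ left (add a b) = left b := by
  cases a with
  | zero => right; simp [add]
  | node a c =>
    cases b with
    | zero => left; simp [add]
    | node b d =>
      by_cases h : Lt a b
      · right; simp [add, h]
      · left; simp [add, h, left]

theorem IsCNF.add {a b : CnfTree} (ha : IsCNF a) (hb : IsCNF b) : IsCNF (add a b) := by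
  induction ha with
  | zero => simpa [CnfTree.add] using hb
  | @node s t hs ht hst _ iht =>
    cases b with
    | zero => simpa [CnfTree.add] using IsCNF.node hs ht hst
    | node b d =>
      by_cases h : Lt s b
      · simpa [CnfTree.add, h] using hb
      · simp only [CnfTree.add, h, if_false]
        refine IsCNF.node hs iht ?_
        rcases left_add t (CnfTree.node b d) with h' | h' <;> rw [h']
        · exact hst
        · exact le_of_not_lt _ _ h

theorem IsCNF.omegaPow {a : CnfTree} (ha : IsCNF a) : IsCNF (CnfTree.node a CnfTree.zero) :=
  IsCNF.node ha IsCNF.zero (zero_le a)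

theorem IsCNF.mul {a b : CnfTree} (ha : IsCNF a) (hb : IsCNF b) : IsCNF (mul a b) := by
  cases ha with
  | zero => simpa [CnfTree.mul] using IsCNF.zero
  | @node s t hs ht hst =>
    induction hb with
    | zero => simpa [CnfTree.mul] using IsCNF.zero
    | @node b d hb _ _ _ ihd =>
      by_cases h : b = CnfTree.zero
      · simp only [CnfTree.mul, h, if_true]
        exact (IsCNF.node hs ht hst).add ihd
      · simp only [CnfTree.mul, h, if_false]
        exact (hs.add hb).omegaPow.add ihd

end CnfTree

/-- The type of Cantor normal forms. -/
def Cnf : Type := {t : CnfTree // t.IsCNF}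

namespace Cnf

instance : LT Cnf := ⟨fun a b => CnfTree.Lt a.1 b.1⟩

instance : LE Cnf := ⟨fun a b => CnfTree.Le a.1 b.1⟩

noncomputable instance : Add Cnf := ⟨fun a b => ⟨CnfTree.add a.1 b.1, a.2.add b.2⟩⟩

noncomputable instance : Mul Cnf := ⟨fun a b => ⟨CnfTree.mul a.1 b.1, a.2.mul b.2⟩⟩

/-- Exponentiation with base `ω` on Cantor normal forms. -/
def omegaPow (a : Cnf) : Cnf := ⟨CnfTree.node a.1 CnfTree.zero, a.2.omegaPow⟩

end Cnf

/-! ## Brouwer trees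

The quotient inductive-inductive type of Brouwer trees is built in the standard way: raw terms
for the point constructors, the well-formed ones among them mutually with the relation `≤`, and
the quotient by the equations. -/

/-- Raw Brouwer trees. -/
inductive PreBrw : Type
  | zero : PreBrw
  | succ : PreBrw → PreBrw
  | limit : (ℕ → PreBrw) → PreBrw

namespace PreBrw

mutual

/-- Well-formed raw trees: limits are taken of sequences that are strictly increasing, where
`x < y` means `succ x ≤ y`. -/
inductive Valid : PreBrw → Prop
  | zero : Valid zero
  | succ {x : PreBrw} : Valid x → Valid (succ x)
  | limit {f : ℕ → PreBrw} : (∀ k, Valid (f k)) → (∀ k, Le (succ (f k)) (f (k + 1))) →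
      Valid (limit f)

/-- The relation `≤`, on well-formed raw trees. -/
inductive Le : PreBrw → PreBrw → Prop
  | zero {x : PreBrw} : Valid x → Le zero x
  | trans {x y z : PreBrw} : Le x y → Le y z → Le x z
  | succ_mono {x y : PreBrw} : Le x y → Le (succ x) (succ y)
  | cocone {x : PreBrw} {f : ℕ → PreBrw} (k : ℕ) : Valid (limit f) → Le x (f k) → Le x (limit f)
  | limiting {x : PreBrw} {f : ℕ → PreBrw} : Valid (limit f) → (∀ k, Le (f k) x) →
      Le (limit f) x

end

/-- The equality of Brouwer trees, on well-formed raw trees: limits of bisimilar sequences are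
identified. (Since pointwise equal sequences are bisimilar, `bisim` includes the congruence rule
for `limit`.) -/
inductive Eqv : PreBrw → PreBrw → Prop
  | refl {x : PreBrw} : Valid x → Eqv x x
  | symm {x y : PreBrw} : Eqv x y → Eqv y x
  | trans {x y z : PreBrw} : Eqv x y → Eqv y z → Eqv x z
  | succ_congr {x y : PreBrw} : Eqv x y → Eqv (succ x) (succ y)
  | bisim {f g : ℕ → PreBrw} : Valid (limit f) → Valid (limit g) →
      (∀ k, ∃ n, Le (f k) (g n)) → (∀ k, ∃ n, Le (g k) (f n)) → Eqv (limit f) (limit g)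

/-- Addition, by recursion on the second argument. -/
def add (x : PreBrw) : PreBrw → PreBrw
  | zero => x
  | succ y => succ (add x y)
  | limit f => limit (fun k => add x (f k))

open Classical in
/-- Multiplication, by recursion on the second argument. -/
noncomputable def mul (x : PreBrw) : PreBrw → PreBrw
  | zero => zero
  | succ y => add (mul x y) x
  | limit f => if x = zero then zero else limit (fun k => mul x (f k))

open Classical in
/-- Exponentiation, by recursion on the exponent. -/
noncomputable def exp (x : PreBrw) : PreBrw → PreBrw
  | zero => succ zero
  | succ y => mul (exp x y) x
  | limit f =>
      if x = zero then zero
      else if x = succ zero then succ zero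
      else limit (fun k => exp x (f k))

/-! ### Facts that the operations on the quotient need -/

theorem Valid.seq {f : ℕ → PreBrw} (h : Valid (PreBrw.limit f)) : ∀ k, Valid (f k) := by
  cases h with | limit h _ => exact h

theorem Valid.inc {f : ℕ → PreBrw} (h : Valid (PreBrw.limit f)) :
    ∀ k, Le (PreBrw.succ (f k)) (f (k + 1)) := by
  cases h with | limit _ h => exact h

theorem Le.valid {x y : PreBrw} (h : Le x y) : Valid x ∧ Valid y :=
  Le.rec (motive_1 := fun _ _ => True) (motive_2 := fun x y _ => Valid x ∧ Valid y)
    trivial (fun _ _ => trivial) (fun _ _ _ _ => trivial)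
    (fun h _ => ⟨.zero, h⟩) (fun _ _ h1 h2 => ⟨h1.1, h2.2⟩)
    (fun _ h => ⟨.succ h.1, .succ h.2⟩) (fun _ h _ _ h' => ⟨h'.1, h⟩)
    (fun h _ _ h' => ⟨h, (h' 0).2⟩) h

theorem Valid.le_refl {x : PreBrw} (h : Valid x) : Le x x := by
  induction x with
  | zero => exact .zero h
  | succ x ih => cases h with | succ h => exact .succ_mono (ih h)
  | limit f ih => exact .limiting h fun k => .cocone k h (ih k (h.seq k))

theorem Valid.le_succ {x : PreBrw} (h : Valid x) : Le x (PreBrw.succ x) := by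
  induction x with
  | zero => exact .zero (.succ h)
  | succ x ih => cases h with | succ h => exact .succ_mono (ih h)
  | limit f ih =>
    exact .limiting h fun k => .trans (ih k (h.seq k))
      (.succ_mono (.cocone k h (h.seq k).le_refl))

theorem Eqv.le {x y : PreBrw} (h : Eqv x y) : Le x y ∧ Le y x := by
  induction h with
  | refl h => exact ⟨h.le_refl, h.le_refl⟩
  | symm _ ih => exact ih.symm
  | trans _ _ ih1 ih2 => exact ⟨.trans ih1.1 ih2.1, .trans ih2.2 ih1.2⟩
  | succ_congr _ ih => exact ⟨.succ_mono ih.1, .succ_mono ih.2⟩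
  | bisim hf hg h1 h2 =>
    exact ⟨.limiting hf fun k => (h1 k).elim fun n hn => .cocone n hg hn,
      .limiting hg fun k => (h2 k).elim fun n hn => .cocone n hf hn⟩

theorem Eqv.limit_congr {f g : ℕ → PreBrw} (hf : Valid (PreBrw.limit f))
    (hg : Valid (PreBrw.limit g)) (h : ∀ k, Eqv (f k) (g k)) :
    Eqv (PreBrw.limit f) (PreBrw.limit g) :=
  .bisim hf hg (fun k => ⟨k, (h k).le.1⟩) (fun k => ⟨k, (h k).le.2⟩)

theorem Eqv.eq_zero_iff {x y : PreBrw} (h : Eqv x y) : x = PreBrw.zero ↔ y = PreBrw.zero := by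
  induction h with
  | refl _ => rfl
  | symm _ ih => exact ih.symm
  | trans _ _ ih1 ih2 => exact ih1.trans ih2
  | succ_congr _ _ => simp
  | bisim _ _ _ _ => simp

theorem Eqv.eq_one_iff {x y : PreBrw} (h : Eqv x y) :
    x = PreBrw.succ PreBrw.zero ↔ y = PreBrw.succ PreBrw.zero := by
  induction h with
  | refl _ => rfl
  | symm _ ih => exact ih.symm
  | trans _ _ ih1 ih2 => exact ih1.trans ih2
  | succ_congr h _ => simpa using h.eq_zero_iff
  | bisim _ _ _ _ => simp

theorem Le.eq_zero {x y : PreBrw} (h : Le x y) : y = PreBrw.zero → x = PreBrw.zero :=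
  Le.rec (motive_1 := fun x _ => ∀ f, x = PreBrw.limit f → f 1 ≠ PreBrw.zero)
    (motive_2 := fun x y _ => y = PreBrw.zero → x = PreBrw.zero)
    (by simp) (by simp)
    (fun {f} _ _ _ h' g hg h0 => by
      cases hg
      exact absurd (h' 0 h0) (by simp))
    (fun _ _ _ => rfl) (fun _ _ h1 h2 h => h1 (h2 h)) (by simp) (by simp)
    (fun {x f} _ _ h h' h0 => absurd (h' 1 h0) (h f rfl)) h

theorem Valid.one_le {x : PreBrw} (h : Valid x) (h0 : x ≠ PreBrw.zero) :
    Le (PreBrw.succ PreBrw.zero) x := by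
  cases h with
  | zero => exact absurd rfl h0
  | succ h => exact .succ_mono (.zero h)
  | limit hf hi =>
    exact .cocone 1 (.limit hf hi) (.trans (.succ_mono (.zero (hf 0))) (hi 0))

theorem Valid.two_le {x : PreBrw} (h : Valid x) (h0 : x ≠ PreBrw.zero)
    (h1 : x ≠ PreBrw.succ PreBrw.zero) : Le (PreBrw.succ (PreBrw.succ PreBrw.zero)) x := by
  cases h with
  | zero => exact absurd rfl h0
  | succ h => exact .succ_mono (h.one_le fun h' => h1 (by rw [h']))
  | limit hf hi =>
    exact .cocone 2 (.limit hf hi)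
      (.trans (.succ_mono (.trans (.succ_mono (.zero (hf 0))) (hi 0))) (hi 1))

theorem Le.ne_zero {x : PreBrw} (h : Le (PreBrw.succ PreBrw.zero) x) : x ≠ PreBrw.zero :=
  fun h0 => absurd (h.eq_zero h0) (by simp)

/-! Addition. -/

theorem Valid.add' {x y : PreBrw} (hx : Valid x) (hy : Valid y) :
    Valid (add x y) ∧ Le x (add x y) :=
  Valid.rec (motive_1 := fun y _ => Valid (PreBrw.add x y) ∧ Le x (PreBrw.add x y))
    (motive_2 := fun y z _ => Le (PreBrw.add x y) (PreBrw.add x z))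
    ⟨hx, hx.le_refl⟩ (fun _ h => ⟨.succ h.1, .trans h.2 h.1.le_succ⟩)
    (fun _ _ h h' =>
      have hl : Valid (PreBrw.limit _) := .limit (fun k => (h k).1) h'
      ⟨hl, .cocone 0 hl (h 0).2⟩)
    (fun _ h => h.2) (fun _ _ => .trans) (fun _ => .succ_mono)
    (fun k _ _ h h' => .cocone k h.1 h') (fun _ _ h h' => .limiting h.1 h') hy

theorem Valid.add {x y : PreBrw} (hx : Valid x) (hy : Valid y) : Valid (add x y) :=
  (hx.add' hy).1

theorem Le.add_left {x y z : PreBrw} (hx : Valid x) (h : Le y z) : Le (add x y) (add x z) :=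
  Le.rec (motive_1 := fun _ _ => True)
    (motive_2 := fun y z _ => Le (PreBrw.add x y) (PreBrw.add x z))
    trivial (fun _ _ => trivial) (fun _ _ _ _ => trivial)
    (fun h _ => (hx.add' h).2) (fun _ _ => .trans) (fun _ => .succ_mono)
    (fun k h _ _ h' => .cocone k (hx.add h) h') (fun h _ _ h' => .limiting (hx.add h) h') h

theorem Le.add_right {x x' y : PreBrw} (h : Le x x') (hy : Valid y) :
    Le (add x y) (add x' y) := by
  induction y with
  | zero => exact h
  | succ y ih => cases hy with | succ hy => exact .succ_mono (ih hy)
  | limit f ih =>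
    exact .limiting (h.valid.1.add hy) fun k => .cocone k (h.valid.2.add hy) (ih k (hy.seq k))

theorem Eqv.add {x x' y y' : PreBrw} (hx : Eqv x x') (hy : Eqv y y') :
    Eqv (add x y) (add x' y') := by
  have h1 : Eqv (PreBrw.add x y) (PreBrw.add x' y) := by
    have hv := hy.le.1.valid.1
    clear hy
    induction y with
    | zero => exact hx
    | succ y ih => cases hv with | succ hy => exact .succ_congr (ih hy)
    | limit f ih =>
      exact .limit_congr (hx.le.1.valid.1.add hv) (hx.le.1.valid.2.add hv)
        fun k => ih k (hv.seq k)
  have hv := hx.le.1.valid.2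
  refine .trans h1 ?_
  clear h1 hx
  induction hy with
  | refl h => exact .refl (hv.add h)
  | symm _ ih => exact .symm ih
  | trans _ _ ih1 ih2 => exact .trans ih1 ih2
  | succ_congr _ ih => exact .succ_congr ih
  | bisim hf hg h1 h2 =>
    exact .bisim (hv.add hf) (hv.add hg) (fun k => (h1 k).imp fun _ h => h.add_left hv)
      (fun k => (h2 k).imp fun _ h => h.add_left hv)

theorem Valid.le_zero_add {x : PreBrw} (h : Valid x) : Le x (PreBrw.add PreBrw.zero x) := by
  induction x with
  | zero => exact .zero .zero
  | succ x ih => cases h with | succ h => exact .succ_mono (ih h)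
  | limit f ih =>
    exact .limiting h fun k => .cocone k (Valid.zero.add h) (ih k (h.seq k))

/-! Multiplication. -/

theorem zero_mul (y : PreBrw) : mul zero y = zero := by
  induction y with
  | zero => rfl
  | succ y ih => exact ih
  | limit f _ => simp [mul]

theorem mul_limit {x : PreBrw} (h0 : x ≠ zero) (f : ℕ → PreBrw) :
    mul x (limit f) = limit (fun k => mul x (f k)) := by
  simp [mul, h0]

theorem inc_mul {x a b : PreBrw} (hx : Valid x) (h0 : x ≠ zero) (ha : Valid a)
    (h : Le (add a x) b) : Le (succ a) b :=
  .trans (Le.add_left ha (hx.one_le h0)) h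

theorem Valid.mul {x y : PreBrw} (hx : Valid x) (hy : Valid y) : Valid (mul x y) := by
  by_cases h0 : x = PreBrw.zero
  · rw [h0, zero_mul]; exact .zero
  · exact Valid.rec (motive_1 := fun y _ => Valid (PreBrw.mul x y))
      (motive_2 := fun y z _ => Le (PreBrw.mul x y) (PreBrw.mul x z))
      .zero (fun _ h => h.add hx)
      (fun _ _ h h' => by
        rw [mul_limit h0]
        exact .limit h fun k => inc_mul hx h0 (h k) (h' k))
      (fun _ h => .zero h) (fun _ _ => .trans) (fun _ h => h.add_right hx)
      (fun k _ _ h h' => by rw [mul_limit h0] at h ⊢; exact .cocone k h h')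
      (fun _ _ h h' => by rw [mul_limit h0] at h ⊢; exact .limiting h h') hy

theorem Le.mul_left {x y z : PreBrw} (hx : Valid x) (h : Le y z) : Le (mul x y) (mul x z) := by
  by_cases h0 : x = PreBrw.zero
  · rw [h0, zero_mul, zero_mul]; exact .zero .zero
  · exact Le.rec (motive_1 := fun _ _ => True)
      (motive_2 := fun y z _ => Le (PreBrw.mul x y) (PreBrw.mul x z))
      trivial (fun _ _ => trivial) (fun _ _ _ _ => trivial)
      (fun h _ => .zero (hx.mul h)) (fun _ _ => .trans) (fun _ h => h.add_right hx)
      (fun k h _ _ h' => by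
        have := hx.mul h
        rw [mul_limit h0] at this ⊢
        exact .cocone k this h')
      (fun h _ _ h' => by
        have := hx.mul h
        rw [mul_limit h0] at this ⊢
        exact .limiting this h') h

theorem Le.mul_right {x x' y : PreBrw} (h : Le x x') (hy : Valid y) :
    Le (mul x y) (mul x' y) := by
  by_cases h0 : x = PreBrw.zero
  · rw [h0, zero_mul]; exact .zero (h.valid.2.mul hy)
  have h0' : x' ≠ PreBrw.zero := fun h' => h0 (h.eq_zero h')
  induction y with
  | zero => exact .zero .zero
  | succ y ih =>
    cases hy with
    | succ hy => exact .trans ((ih hy).add_right h.valid.1) (h.add_left (h.valid.2.mul hy))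
  | limit f ih =>
    have h1 := h.valid.1.mul hy
    have h2 := h.valid.2.mul hy
    rw [mul_limit h0] at h1 ⊢
    rw [mul_limit h0'] at h2 ⊢
    exact .limiting h1 fun k => .cocone k h2 (ih k (hy.seq k))

theorem Eqv.mul {x x' y y' : PreBrw} (hx : Eqv x x') (hy : Eqv y y') :
    Eqv (mul x y) (mul x' y') := by
  by_cases h0 : x = PreBrw.zero
  · rw [h0, hx.eq_zero_iff.1 h0, zero_mul, zero_mul]; exact .refl .zero
  have h0' : x' ≠ PreBrw.zero := fun h => h0 (hx.eq_zero_iff.2 h)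
  have h1 : Eqv (PreBrw.mul x y) (PreBrw.mul x' y) := by
    have hv := hy.le.1.valid.1
    clear hy
    induction y with
    | zero => exact .refl .zero
    | succ y ih => cases hv with | succ hy => exact (ih hy).add hx
    | limit f ih =>
      have h1 := hx.le.1.valid.1.mul hv
      have h2 := hx.le.1.valid.2.mul hv
      rw [mul_limit h0] at h1 ⊢
      rw [mul_limit h0'] at h2 ⊢
      exact .limit_congr h1 h2 fun k => ih k (hv.seq k)
  have hv := hx.le.1.valid.2
  refine .trans h1 ?_
  clear h1 hx
  induction hy with
  | refl h => exact .refl (hv.mul h)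
  | symm _ ih => exact .symm ih
  | trans _ _ ih1 ih2 => exact .trans ih1 ih2
  | succ_congr _ ih => exact ih.add (.refl hv)
  | bisim hf hg h1 h2 =>
    have hf' := hv.mul hf
    have hg' := hv.mul hg
    rw [mul_limit h0'] at hf' hg' ⊢
    rw [mul_limit h0']
    exact .bisim hf' hg' (fun k => (h1 k).imp fun _ h => h.mul_left hv)
      (fun k => (h2 k).imp fun _ h => h.mul_left hv)

theorem one_le_mul {x y : PreBrw} (hx : Le (succ zero) x) (hy : Le (succ zero) y) :
    Le (succ zero) (mul x y) :=
  .trans (Le.add_left .zero hx) (hy.mul_left hx.valid.2)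

/-! Exponentiation. -/

theorem exp_limit {x : PreBrw} (h0 : x ≠ zero) (h1 : x ≠ succ zero) (f : ℕ → PreBrw) :
    exp x (limit f) = limit (fun k => exp x (f k)) := by
  simp [exp, h0, h1]

theorem inc_exp {x a b : PreBrw} (hx : Le (succ (succ zero)) x) (ha : Valid a)
    (ha1 : Le (succ zero) a) (h : Le (mul a x) b) : Le (succ a) b :=
  .trans (.trans (.trans (.succ_mono ha.le_zero_add) (Le.add_left (Valid.zero.add ha) ha1))
    (hx.mul_left ha)) h

theorem Valid.exp' {x y : PreBrw} (hx : Valid x) (h0 : x ≠ PreBrw.zero)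
    (h1 : x ≠ PreBrw.succ PreBrw.zero) (hy : Valid y) :
    Valid (exp x y) ∧ Le (PreBrw.succ PreBrw.zero) (exp x y) :=
  Valid.rec
    (motive_1 := fun y _ =>
      Valid (PreBrw.exp x y) ∧ Le (PreBrw.succ PreBrw.zero) (PreBrw.exp x y))
    (motive_2 := fun y z _ => Le (PreBrw.exp x y) (PreBrw.exp x z))
    ⟨.succ .zero, (Valid.succ .zero).le_refl⟩
    (fun _ h => ⟨h.1.mul hx, one_le_mul h.2 (hx.one_le h0)⟩)
    (fun {f} _ _ h h' => by
      rw [exp_limit h0 h1]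
      have hl : Valid (PreBrw.limit fun k => PreBrw.exp x (f k)) := .limit (fun k => (h k).1)
        fun k => inc_exp (hx.two_le h0 h1) (h k).1 (h k).2 (h' k)
      exact ⟨hl, .cocone 0 hl (h 0).2⟩)
    (fun _ h => h.2) (fun _ _ => .trans) (fun _ h => h.mul_right hx)
    (fun k _ _ h h' => by rw [exp_limit h0 h1] at h ⊢; exact .cocone k h.1 h')
    (fun _ _ h h' => by rw [exp_limit h0 h1] at h ⊢; exact .limiting h.1 h') hy

theorem Valid.exp {x y : PreBrw} (hx : Valid x) (hy : Valid y) : Valid (exp x y) := by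
  by_cases h : x ≠ PreBrw.zero ∧ x ≠ PreBrw.succ PreBrw.zero
  · exact (hx.exp' h.1 h.2 hy).1
  · induction y with
    | zero => exact .succ .zero
    | succ y ih => cases hy with | succ hy => exact (ih hy).mul hx
    | limit f _ =>
      by_cases h0 : x = PreBrw.zero
      · simpa [PreBrw.exp, h0] using Valid.zero
      · have h1 : x = PreBrw.succ PreBrw.zero := by tauto
        simpa [PreBrw.exp, h1] using Valid.succ Valid.zero

theorem Le.exp_left {x y z : PreBrw} (hx : Valid x) (h0 : x ≠ PreBrw.zero)
    (h1 : x ≠ PreBrw.succ PreBrw.zero) (h : Le y z) : Le (exp x y) (exp x z) :=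
  Le.rec (motive_1 := fun _ _ => True)
    (motive_2 := fun y z _ => Le (PreBrw.exp x y) (PreBrw.exp x z))
    trivial (fun _ _ => trivial) (fun _ _ _ _ => trivial)
    (fun h _ => (hx.exp' h0 h1 h).2) (fun _ _ => .trans) (fun _ h => h.mul_right hx)
    (fun k h _ _ h' => by
      have := hx.exp h
      rw [exp_limit h0 h1] at this ⊢
      exact .cocone k this h')
    (fun h _ _ h' => by
      have := hx.exp h
      rw [exp_limit h0 h1] at this ⊢
      exact .limiting this h') h

theorem Eqv.exp {x x' y y' : PreBrw} (hx : Eqv x x') (hy : Eqv y y') :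
    Eqv (exp x y) (exp x' y') := by
  have h1 : Eqv (PreBrw.exp x y) (PreBrw.exp x' y) := by
    have hv := hy.le.1.valid.1
    clear hy
    induction y with
    | zero => exact .refl (.succ .zero)
    | succ y ih => cases hv with | succ hy => exact (ih hy).mul hx
    | limit f ih =>
      by_cases h0 : x = PreBrw.zero
      · rw [hx.eq_zero_iff.1 h0, h0]; exact .refl (Valid.zero.exp hv)
      by_cases h1 : x = PreBrw.succ PreBrw.zero
      · rw [hx.eq_one_iff.1 h1, h1]; exact .refl ((Valid.succ .zero).exp hv)
      have hf := hx.le.1.valid.1.exp hv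
      have hf' := hx.le.1.valid.2.exp hv
      rw [exp_limit h0 h1] at hf ⊢
      rw [exp_limit (mt hx.eq_zero_iff.2 h0) (mt hx.eq_one_iff.2 h1)] at hf' ⊢
      exact .limit_congr hf hf' fun k => ih k (hv.seq k)
  have hv := hx.le.1.valid.2
  refine .trans h1 ?_
  clear h1 hx
  induction hy with
  | refl h => exact .refl (hv.exp h)
  | symm _ ih => exact .symm ih
  | trans _ _ ih1 ih2 => exact .trans ih1 ih2
  | succ_congr _ ih => exact ih.mul (.refl hv)
  | bisim hf hg h h' =>
    by_cases h0 : x' = PreBrw.zero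
    · simpa [PreBrw.exp, h0] using Eqv.refl .zero
    by_cases h1 : x' = PreBrw.succ PreBrw.zero
    · simpa [PreBrw.exp, h1] using Eqv.refl (.succ .zero)
    have hf' := hv.exp hf
    have hg' := hv.exp hg
    rw [exp_limit h0 h1] at hf' hg' ⊢
    rw [exp_limit h0 h1]
    exact .bisim hf' hg' (fun k => (h k).imp fun _ h => h.exp_left hv h0 h1)
      (fun k => (h' k).imp fun _ h => h.exp_left hv h0 h1)

/-- Well-formed raw trees up to the equality of Brouwer trees. -/
instance setoid : Setoid {x : PreBrw // Valid x} where
  r x y := Eqv x.1 y.1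
  iseqv := ⟨fun x => .refl x.2, .symm, .trans⟩

end PreBrw

/-- The type of Brouwer trees. -/
def Brw : Type := Quotient PreBrw.setoid

namespace Brw

/-- The Brouwer tree given by a well-formed raw tree. -/
def mk (x : PreBrw) (hx : x.Valid) : Brw := Quotient.mk PreBrw.setoid ⟨x, hx⟩

instance : LE Brw :=
  ⟨Quotient.lift₂ (fun x y => PreBrw.Le x.1 y.1) fun _ _ _ _ hx hy => propext
    ⟨fun h => .trans (PreBrw.Eqv.le hx).2 (.trans h (PreBrw.Eqv.le hy).1),
      fun h => .trans (PreBrw.Eqv.le hx).1 (.trans h (PreBrw.Eqv.le hy).2)⟩⟩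

/-- The constructor `zero`. -/
def zero : Brw := mk PreBrw.zero .zero

/-- The constructor `succ`. -/
def succ : Brw → Brw :=
  Quotient.map (fun x => ⟨PreBrw.succ x.1, .succ x.2⟩) fun _ _ h => PreBrw.Eqv.succ_congr h

/-- `x < y` means `succ x ≤ y`. -/
instance : LT Brw := ⟨fun x y => succ x ≤ y⟩

/-- A raw representative of a Brouwer tree. -/
noncomputable def rep (x : Brw) : PreBrw := (Quotient.out x).1

theorem rep_valid (x : Brw) : x.rep.Valid := (Quotient.out x).2

theorem mk_rep (x : Brw) : mk x.rep x.rep_valid = x := Quotient.out_eq x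

theorem rep_inc {f : ℕ → Brw} (hf : ∀ k, f k < f (k + 1)) :
    (PreBrw.limit fun k => (f k).rep).Valid := by
  refine .limit (fun k => (f k).rep_valid) fun k => ?_
  have h := hf k
  rw [← mk_rep (f k), ← mk_rep (f (k + 1))] at h
  exact h

/-- The constructor `limit`, for strictly increasing sequences. -/
noncomputable def limit (f : ℕ → Brw) (hf : ∀ k, f k < f (k + 1)) : Brw :=
  mk (PreBrw.limit fun k => (f k).rep) (rep_inc hf)

instance : Add Brw :=
  ⟨Quotient.map₂ (fun x y => ⟨PreBrw.add x.1 y.1, x.2.add y.2⟩)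
    fun _ _ hx _ _ hy => PreBrw.Eqv.add hx hy⟩

noncomputable instance : Mul Brw :=
  ⟨Quotient.map₂ (fun x y => ⟨PreBrw.mul x.1 y.1, x.2.mul y.2⟩)
    fun _ _ hx _ _ hy => PreBrw.Eqv.mul hx hy⟩

noncomputable instance : Pow Brw Brw :=
  ⟨Quotient.map₂ (fun x y => ⟨PreBrw.exp x.1 y.1, x.2.exp y.2⟩)
    fun _ _ hx _ _ hy => PreBrw.Eqv.exp hx hy⟩

/-! ### The constructors, their induction principles, and the defining equations -/

theorem mk_eq_mk {x y : PreBrw} {hx : x.Valid} {hy : y.Valid} :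
    mk x hx = mk y hy ↔ PreBrw.Eqv x y :=
  ⟨fun h => Quotient.exact h, fun h => Quotient.sound h⟩

theorem mk_le_mk {x y : PreBrw} {hx : x.Valid} {hy : y.Valid} :
    mk x hx ≤ mk y hy ↔ PreBrw.Le x y := Iff.rfl

theorem rep_mk {x : PreBrw} (hx : x.Valid) : PreBrw.Eqv (mk x hx).rep x :=
  mk_eq_mk.1 (mk_rep (mk x hx))

theorem rep_le_rep {x y : Brw} : PreBrw.Le x.rep y.rep ↔ x ≤ y := by
  conv_rhs => rw [← mk_rep x, ← mk_rep y]
  exact Iff.rfl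

theorem mk_limit {f : ℕ → PreBrw} (hf : (PreBrw.limit f).Valid) :
    mk (PreBrw.limit f) hf = limit (fun k => mk (f k) (hf.seq k)) hf.inc :=
  mk_eq_mk.2 (.limit_congr hf (rep_inc hf.inc) fun k => (rep_mk (hf.seq k)).symm)

theorem bisim {f g : ℕ → Brw} (hf : ∀ k, f k < f (k + 1)) (hg : ∀ k, g k < g (k + 1))
    (h : ∀ k, ∃ n, f k ≤ g n) (h' : ∀ k, ∃ n, g k ≤ f n) : limit f hf = limit g hg :=
  mk_eq_mk.2 (.bisim (rep_inc hf) (rep_inc hg) (fun k => (h k).imp fun _ => rep_le_rep.2)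
    (fun k => (h' k).imp fun _ => rep_le_rep.2))

theorem zero_le (x : Brw) : zero ≤ x := by
  rw [← mk_rep x]
  exact PreBrw.Le.zero x.rep_valid

theorem le_trans {x y z : Brw} (h : x ≤ y) (h' : y ≤ z) : x ≤ z :=
  rep_le_rep.1 (.trans (rep_le_rep.2 h) (rep_le_rep.2 h'))

theorem succ_mono {x y : Brw} (h : x ≤ y) : succ x ≤ succ y := by
  rw [← mk_rep x, ← mk_rep y] at h ⊢
  exact PreBrw.Le.succ_mono h

theorem le_cocone {x : Brw} {f : ℕ → Brw} (hf : ∀ k, f k < f (k + 1)) (k : ℕ) (h : x ≤ f k) :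
    x ≤ limit f hf := by
  have h' := PreBrw.Le.cocone k (rep_inc hf) (rep_le_rep.2 h)
  rw [← mk_rep x]
  exact h'

theorem limit_le {x : Brw} {f : ℕ → Brw} (hf : ∀ k, f k < f (k + 1)) (h : ∀ k, f k ≤ x) :
    limit f hf ≤ x := by
  have h' := PreBrw.Le.limiting (rep_inc hf) (fun k => rep_le_rep.2 (h k))
  rw [← mk_rep x]
  exact h'

theorem induction_on {P : Brw → Prop} (h0 : P zero) (hs : ∀ x, P x → P (succ x))
    (hl : ∀ f hf, (∀ k, P (f k)) → P (limit f hf)) (x : Brw) : P x := by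
  rw [← mk_rep x]
  generalize x.rep_valid = hx
  generalize x.rep = y at hx
  induction y with
  | zero => exact h0
  | succ y ih => cases hx with | succ hy => exact hs _ (ih hy)
  | limit f ih => rw [mk_limit hx]; exact hl _ _ fun k => ih k (hx.seq k)

theorem le_induction {R : Brw → Brw → Prop} (h0 : ∀ x, R zero x)
    (ht : ∀ x y z, R x y → R y z → R x z) (hs : ∀ x y, R x y → R (succ x) (succ y))
    (hc : ∀ x f hf k, R x (f k) → R x (limit f hf))
    (hl : ∀ x f hf, (∀ k, R (f k) x) → R (limit f hf) x) {x y : Brw} (h : x ≤ y) : R x y := by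
  rw [← mk_rep x, ← mk_rep y]
  have h' := rep_le_rep.2 h
  exact PreBrw.Le.rec (motive_1 := fun _ _ => True)
    (motive_2 := fun x y _ => ∀ hx hy, R (mk x hx) (mk y hy))
    trivial (fun _ _ => trivial) (fun _ _ _ _ => trivial)
    (fun _ _ _ _ => h0 _)
    (fun h _ i j hx hy => ht _ _ _ (i hx h.valid.2) (j h.valid.2 hy))
    (fun h i _ _ => hs _ _ (i h.valid.1 h.valid.2))
    (fun k _ _ _ i hx hy => by rw [mk_limit hy]; exact hc _ _ _ k (i hx (hy.seq k)))
    (fun _ _ _ i hx hy => by rw [mk_limit hx]; exact hl _ _ _ fun k => i k (hx.seq k) hy)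
    h' _ _

theorem add_zero (x : Brw) : x + zero = x := by
  rw [← mk_rep x]; rfl

theorem add_succ (x y : Brw) : x + succ y = succ (x + y) := by
  rw [← mk_rep x, ← mk_rep y]; rfl

theorem mk_add_mk {x y : PreBrw} (hx : x.Valid) (hy : y.Valid) :
    mk x hx + mk y hy = mk (x.add y) (hx.add hy) := rfl

theorem mk_mul_mk {x y : PreBrw} (hx : x.Valid) (hy : y.Valid) :
    mk x hx * mk y hy = mk (x.mul y) (hx.mul hy) := rfl

theorem mk_pow_mk {x y : PreBrw} (hx : x.Valid) (hy : y.Valid) :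
    mk x hx ^ mk y hy = mk (x.exp y) (hx.exp hy) := rfl

theorem mk_limit' {f : ℕ → PreBrw} (hf : (PreBrw.limit f).Valid) {g : ℕ → Brw}
    (h : ∀ k, g k = mk (f k) (hf.seq k)) :
    ∃ hg, mk (PreBrw.limit f) hf = limit g hg := by
  obtain rfl : g = fun k => mk (f k) (hf.seq k) := funext h
  exact ⟨_, mk_limit hf⟩

theorem add_limit (x : Brw) (f : ℕ → Brw) (hf : ∀ k, f k < f (k + 1)) :
    ∃ hg, x + limit f hf = limit (fun k => x + f k) hg :=
  have hv := x.rep_valid.add (rep_inc hf)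
  (mk_limit' hv (g := fun k => x + f k) fun k => by
    conv_lhs => rw [← mk_rep x, ← mk_rep (f k)]
    rfl).imp fun _ h => by
      rw [← h]
      conv_lhs => rw [← mk_rep x]
      rfl

theorem mul_zero (x : Brw) : x * zero = zero := by
  rw [← mk_rep x]; rfl

theorem mul_succ (x y : Brw) : x * succ y = x * y + x := by
  rw [← mk_rep x, ← mk_rep y]; rfl

theorem rep_eq_zero {x : Brw} : x.rep = PreBrw.zero ↔ x = zero := by
  constructor
  · intro h
    rw [← mk_rep x]
    exact mk_eq_mk.2 (by rw [h]; exact .refl .zero)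
  · rintro rfl
    exact (rep_mk .zero).eq_zero_iff.2 rfl

theorem rep_eq_one {x : Brw} : x.rep = PreBrw.succ PreBrw.zero ↔ x = succ zero := by
  constructor
  · intro h
    rw [← mk_rep x]
    exact mk_eq_mk.2 (by rw [h]; exact .refl (.succ .zero))
  · rintro rfl
    exact (rep_mk (.succ .zero)).eq_one_iff.2 rfl

theorem zero_mul (y : Brw) : zero * y = zero := by
  rw [← mk_rep y]
  exact mk_eq_mk.2 (by rw [PreBrw.zero_mul]; exact .refl .zero)

theorem mul_limit {x : Brw} (hx : x ≠ zero) (f : ℕ → Brw) (hf : ∀ k, f k < f (k + 1)) :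
    ∃ hg, x * limit f hf = limit (fun k => x * f k) hg := by
  have h0 := mt rep_eq_zero.1 hx
  have hv := x.rep_valid.mul (rep_inc hf)
  have he := PreBrw.mul_limit h0 fun k => (f k).rep
  have hv' := he ▸ hv
  refine (mk_limit' hv' (g := fun k => x * f k) fun k => ?_).imp fun _ h => ?_
  · conv_lhs => rw [← mk_rep x, ← mk_rep (f k)]
    rfl
  · rw [← h]
    conv_lhs => rw [← mk_rep x]
    exact mk_eq_mk.2 (he ▸ .refl hv)

theorem pow_zero (x : Brw) : x ^ zero = succ zero := by
  rw [← mk_rep x]; rfl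

theorem pow_succ (x y : Brw) : x ^ succ y = x ^ y * x := by
  rw [← mk_rep x, ← mk_rep y]; rfl

theorem zero_pow_limit (f : ℕ → Brw) (hf : ∀ k, f k < f (k + 1)) : zero ^ limit f hf = zero :=
  mk_eq_mk.2 (by simpa [PreBrw.exp] using PreBrw.Eqv.refl .zero)

theorem one_pow_limit (f : ℕ → Brw) (hf : ∀ k, f k < f (k + 1)) :
    succ zero ^ limit f hf = succ zero :=
  mk_eq_mk.2 (by simpa [PreBrw.exp] using PreBrw.Eqv.refl (.succ .zero))

theorem pow_limit {x : Brw} (h0 : x ≠ zero) (h1 : x ≠ succ zero) (f : ℕ → Brw)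
    (hf : ∀ k, f k < f (k + 1)) :
    ∃ hg, x ^ limit f hf = limit (fun k => x ^ f k) hg := by
  have hv := x.rep_valid.exp (rep_inc hf)
  have he := PreBrw.exp_limit (mt rep_eq_zero.1 h0) (mt rep_eq_one.1 h1) fun k => (f k).rep
  have hv' := he ▸ hv
  refine (mk_limit' hv' (g := fun k => x ^ f k) fun k => ?_).imp fun _ h => ?_
  · conv_lhs => rw [← mk_rep x, ← mk_rep (f k)]
    rfl
  · rw [← h]
    conv_lhs => rw [← mk_rep x]
    exact mk_eq_mk.2 (he ▸ .refl hv)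

/-! ### The ordinal `ω` -/

/-- The finite Brouwer trees. -/
def ofNat : ℕ → Brw
  | 0 => zero
  | n + 1 => succ (ofNat n)

theorem le_refl (x : Brw) : x ≤ x := rep_le_rep.1 x.rep_valid.le_refl

/-- `ω` is the limit of the finite Brouwer trees. -/
noncomputable def omega : Brw := limit ofNat fun k => le_refl (ofNat (k + 1))

end Brw

/-! ## From Cantor normal forms to Brouwer trees -/

/-- The Brouwer tree denoted by a binary tree. -/
noncomputable def CnfTree.toBrw : CnfTree → Brw
  | zero => Brw.zero
  | node a b => Brw.omega ^ toBrw a + toBrw b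

/-- The map from Cantor normal forms to Brouwer trees. -/
noncomputable def CtoB (a : Cnf) : Brw := a.1.toBrw

/-! ## The ordinal denoted by a Brouwer tree -/

-- Both types are compared with the ordinals, where every claim is classical. Send a Brouwer tree to
-- its ordinal, limits going to suprema. This reflects the order and is injective
-- (`Brw.toOrdinal_le_iff`, `Brw.toOrdinal_injective`): an ordinal below a supremum is below one of
-- its terms, which is what the rules for `limit` and the bisimulation rule require. It preserves
-- sums, products and powers of `omega`, since the ordinal operations are normal in the second
-- argument and so commute with suprema. Read a Cantor normal form as `ω ^ a + b`. Powers of `ω` are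
-- additively principal, so a form lies below `ω ^ c` once its leading exponent is below `c`; hence
-- the reading is strictly monotone, and an order embedding because the lexicographical order is
-- total. It preserves sums by absorption, and products by left distributivity and
-- `mul_omega0_opow_of_lt`. `CtoB` preserves the denoted ordinal (`toOrdinal_CtoB`), so each claim
-- holds because both sides have the same description in terms of ordinals.

/-- The ordinal denoted by a raw Brouwer tree. -/
noncomputable def PreBrw.toOrdinal : PreBrw → Ordinal.{0}
  | zero => 0
  | succ x => toOrdinal x + 1
  | limit f => ⨆ k, toOrdinal (f k)

namespace PreBrw

-- Order and equality of raw trees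

theorem Le.toOrdinal_le {x y : PreBrw} (h : Le x y) : x.toOrdinal ≤ y.toOrdinal :=
  Le.rec (motive_1 := fun _ _ => True) (motive_2 := fun x y _ => x.toOrdinal ≤ y.toOrdinal)
    trivial (fun _ _ => trivial) (fun _ _ _ _ => trivial)
    (fun _ _ => zero_le) (fun _ _ => le_trans) (fun _ h => add_le_add_left h 1)
    (fun {_ f} k _ _ _ h => h.trans (Ordinal.le_iSup (fun k => (f k).toOrdinal) k))
    (fun _ _ _ h => Ordinal.iSup_le h) h

theorem Valid.toOrdinal_lt_limit {f : ℕ → PreBrw} (h : Valid (PreBrw.limit f)) (k : ℕ) :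
    (f k).toOrdinal < (PreBrw.limit f).toOrdinal :=
  (Order.add_one_le_iff.1 (h.inc k).toOrdinal_le).trans_le
    (Ordinal.le_iSup (fun k => (f k).toOrdinal) (k + 1))

/-- A derivation of `Le` is rebuilt from the ordinals. Only a successor on the left needs an inner
induction on `y`: when `y` is a limit, the predecessor lies strictly below a supremum, hence
strictly below a term, and the successor is at most that term. -/
theorem Valid.le_of_toOrdinal_le {x y : PreBrw} (hx : Valid x) (hy : Valid y)
    (h : x.toOrdinal ≤ y.toOrdinal) : Le x y := by
  induction x generalizing y with
  | zero => exact .zero hy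
  | limit f ih =>
    exact .limiting hx fun k => ih k (hx.seq k) hy ((hx.toOrdinal_lt_limit k).le.trans h)
  | succ x ih =>
    cases hx with | succ hx => ?_
    induction y with
    | zero => simp [toOrdinal] at h
    | succ y _ =>
      cases hy with | succ hy => exact .succ_mono (ih hx hy (by simpa [toOrdinal] using h))
    | limit g ihg =>
      obtain ⟨k, hk⟩ := Ordinal.lt_iSup_iff.1 (Order.add_one_le_iff.1 h)
      exact .cocone k hy (ihg k (hy.seq k) (Order.add_one_le_of_lt hk))

/-- The supremum is not attained: if it were `o + 1`, some term would exceed `o`, hence be at least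
the supremum. -/
theorem Valid.limit_toOrdinal_ne_succ {f : ℕ → PreBrw} (h : Valid (PreBrw.limit f)) (o : Ordinal) :
    (PreBrw.limit f).toOrdinal ≠ o + 1 := by
  intro ho
  obtain ⟨k, hk⟩ := Ordinal.lt_iSup_iff.1 ((lt_add_one o).trans_eq ho.symm)
  exact (h.toOrdinal_lt_limit k).not_ge (ho.trans_le (Order.add_one_le_of_lt hk))

/-- Antisymmetry is not a rule of `Eqv`, so it has to be derived. The ordinal determines the
outermost constructor (zero, successor or limit), and two limits with the same supremum are mutually
cofinal, hence bisimilar. -/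
theorem Valid.eqv_of_toOrdinal_eq {x y : PreBrw} (hx : Valid x) (hy : Valid y)
    (h : x.toOrdinal = y.toOrdinal) : Eqv x y := by
  induction x generalizing y with
  | zero =>
    rw [(hy.le_of_toOrdinal_le hx h.ge).eq_zero rfl]
    exact .refl .zero
  | succ x ih =>
    cases hx with | succ hx => ?_
    cases y with
    | zero => simp [toOrdinal] at h
    | succ y =>
      cases hy with | succ hy => exact .succ_congr (ih hx hy (by simpa [toOrdinal] using h))
    | limit g => exact absurd h.symm (hy.limit_toOrdinal_ne_succ _)
  | limit f _ =>
    cases y with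
    | zero =>
      have h' := hx.toOrdinal_lt_limit 0
      rw [h] at h'
      exact absurd h' not_lt_zero
    | succ y => exact absurd h (hx.limit_toOrdinal_ne_succ _)
    | limit g =>
      have key : ∀ {f g : ℕ → PreBrw}, Valid (PreBrw.limit f) → Valid (PreBrw.limit g) →
          (PreBrw.limit f).toOrdinal ≤ (PreBrw.limit g).toOrdinal → ∀ k, ∃ n, Le (f k) (g n) :=
        fun hf hg h k =>
          (Ordinal.lt_iSup_iff.1 ((hf.toOrdinal_lt_limit k).trans_le h)).imp
            fun n hn => (hf.seq k).le_of_toOrdinal_le (hg.seq n) hn.le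
      exact .bisim hx hy (key hx hy h.le) (key hy hx h.ge)

-- Arithmetic of raw trees

theorem toOrdinal_add (x y : PreBrw) : (add x y).toOrdinal = x.toOrdinal + y.toOrdinal := by
  induction y with
  | zero => simp [add, toOrdinal]
  | succ y ih => simp only [add, toOrdinal, ih, add_assoc]
  | limit f ih =>
    simp only [add, toOrdinal, ih]
    exact ((Ordinal.isNormal_add_right _).map_iSup Ordinal.bddAbove_of_small).symm

theorem toOrdinal_mul (x y : PreBrw) : (mul x y).toOrdinal = x.toOrdinal * y.toOrdinal := by
  induction y with
  | zero => simp [mul, toOrdinal]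
  | succ y ih => simp only [mul, toOrdinal, toOrdinal_add, ih, mul_add_one]
  | limit f ih =>
    by_cases hx : x = zero
    · simp [mul, hx, toOrdinal]
    -- An ill-formed raw tree, such as the limit of a constant sequence of zeros, denotes `0`
    -- without being `zero`; multiplication by `0` is not normal, so this case is separate.
    rcases eq_or_ne x.toOrdinal 0 with h0 | h0
    · simp [mul, hx, toOrdinal, ih, h0]
    · simp only [mul, hx, if_false, toOrdinal, ih]
      exact ((Ordinal.isNormal_mul_right (pos_iff_ne_zero.2 h0)).map_iSup
        Ordinal.bddAbove_of_small).symm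

/-- The base that matters is `omega`. A base above `1` makes the power normal in the exponent, and
avoids the two bases that `exp` treats separately at limits. -/
theorem toOrdinal_exp {x : PreBrw} (hx : 1 < x.toOrdinal) (y : PreBrw) :
    (exp x y).toOrdinal = x.toOrdinal ^ y.toOrdinal := by
  have h0 : x ≠ zero := by rintro rfl; simp [toOrdinal] at hx
  have h1 : x ≠ succ zero := by rintro rfl; simp [toOrdinal] at hx
  induction y with
  | zero => simp [exp, toOrdinal]
  | succ y ih => simp only [exp, toOrdinal, toOrdinal_mul, ih, Ordinal.opow_add_one]
  | limit f ih =>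
    simp only [exp, h0, h1, if_false, toOrdinal, ih]
    exact ((Ordinal.isNormal_opow hx).map_iSup Ordinal.bddAbove_of_small).symm

end PreBrw

-- Passage to the quotient

namespace Brw

/-- The ordinal denoted by a Brouwer tree. -/
noncomputable def toOrdinal : Brw → Ordinal.{0} :=
  Quotient.lift (fun x => x.1.toOrdinal) fun _ _ h =>
    le_antisymm (PreBrw.Eqv.le h).1.toOrdinal_le (PreBrw.Eqv.le h).2.toOrdinal_le

theorem toOrdinal_mk {x : PreBrw} (hx : x.Valid) : (mk x hx).toOrdinal = x.toOrdinal := rfl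

theorem toOrdinal_rep (x : Brw) : x.rep.toOrdinal = x.toOrdinal := by
  conv_rhs => rw [← mk_rep x, toOrdinal_mk]

theorem toOrdinal_le_iff {x y : Brw} : x.toOrdinal ≤ y.toOrdinal ↔ x ≤ y := by
  rw [← rep_le_rep, ← toOrdinal_rep x, ← toOrdinal_rep y]
  exact ⟨x.rep_valid.le_of_toOrdinal_le y.rep_valid, PreBrw.Le.toOrdinal_le⟩

theorem toOrdinal_zero : zero.toOrdinal = 0 := rfl

theorem toOrdinal_succ (x : Brw) : (succ x).toOrdinal = x.toOrdinal + 1 := by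
  rw [← mk_rep x]; rfl

theorem toOrdinal_lt_iff {x y : Brw} : x.toOrdinal < y.toOrdinal ↔ x < y := by
  rw [← Order.add_one_le_iff, ← toOrdinal_succ, toOrdinal_le_iff]
  rfl

theorem toOrdinal_injective : Function.Injective toOrdinal := by
  intro x y h
  rw [← mk_rep x, ← mk_rep y] at h ⊢
  exact mk_eq_mk.2 (x.rep_valid.eqv_of_toOrdinal_eq y.rep_valid h)

theorem toOrdinal_limit (f : ℕ → Brw) (hf : ∀ k, f k < f (k + 1)) :
    (limit f hf).toOrdinal = ⨆ k, (f k).toOrdinal :=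
  iSup_congr fun k => toOrdinal_rep (f k)

theorem toOrdinal_ofNat (n : ℕ) : (ofNat n).toOrdinal = n := by
  induction n with
  | zero => simp [ofNat, toOrdinal_zero]
  | succ n ih => rw [ofNat, toOrdinal_succ, ih, Nat.cast_succ]

theorem toOrdinal_omega : omega.toOrdinal = Ordinal.omega0 := by
  refine (toOrdinal_limit ofNat _).trans ?_
  simp only [toOrdinal_ofNat]
  exact Ordinal.iSup_natCast

theorem toOrdinal_add (x y : Brw) : (x + y).toOrdinal = x.toOrdinal + y.toOrdinal := by
  rw [← mk_rep x, ← mk_rep y]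
  exact PreBrw.toOrdinal_add _ _

theorem toOrdinal_mul (x y : Brw) : (x * y).toOrdinal = x.toOrdinal * y.toOrdinal := by
  rw [← mk_rep x, ← mk_rep y]
  exact PreBrw.toOrdinal_mul _ _

theorem toOrdinal_pow {x : Brw} (hx : 1 < x.toOrdinal) (y : Brw) :
    (x ^ y).toOrdinal = x.toOrdinal ^ y.toOrdinal := by
  rw [← mk_rep x] at hx ⊢
  rw [← mk_rep y]
  exact PreBrw.toOrdinal_exp hx _

theorem toOrdinal_omega_pow (x : Brw) :
    (omega ^ x).toOrdinal = Ordinal.omega0 ^ x.toOrdinal := by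
  rw [toOrdinal_pow (toOrdinal_omega ▸ Ordinal.one_lt_omega0), toOrdinal_omega]

end Brw

/-! ## The ordinal denoted by a Cantor normal form -/

namespace CnfTree

open Ordinal

/-- The ordinal denoted by a binary tree. -/
noncomputable def toOrdinal : CnfTree → Ordinal.{0}
  | zero => 0
  | node a b => ω ^ toOrdinal a + toOrdinal b

theorem toOrdinal_toBrw (t : CnfTree) : t.toBrw.toOrdinal = t.toOrdinal := by
  induction t with
  | zero => rfl
  | node a b iha ihb =>
    rw [toBrw, toOrdinal, Brw.toOrdinal_add, Brw.toOrdinal_omega_pow, iha, ihb]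

theorem toOrdinal_node_pos (a b : CnfTree) : 0 < (node a b).toOrdinal :=
  (opow_pos _ omega0_pos).trans_le le_self_add

theorem opow_le_toOrdinal_node (a b : CnfTree) : ω ^ a.toOrdinal ≤ (node a b).toOrdinal :=
  le_self_add

-- The order of Cantor normal forms

theorem Lt.trans {a b c : CnfTree} (h : Lt a b) (h' : Lt b c) : Lt a c := by
  induction h generalizing c with
  | zero_node a b => cases h' <;> exact .zero_node _ _
  | left h ih =>
    cases h' with
    | left h' => exact .left (ih h')
    | right _ => exact .left h
  | right h ih =>
    cases h' with
    | left h' => exact .left h'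
    | right h' => exact .right (ih h')

theorem Le.trans_lt {a b c : CnfTree} (h : Le a b) (h' : Lt b c) : Lt a c := by
  rcases h with h | rfl
  · exact h.trans h'
  · exact h'

/-- If `c` bounds the ordinals of the normal forms below it, then `ω ^ c` bounds the ordinals of
the normal forms whose leading exponent is below `c`. -/
theorem IsCNF.lt_opow_of_forall_lt {c : CnfTree}
    (hc : ∀ s, IsCNF s → Lt s c → s.toOrdinal < c.toOrdinal) {u : CnfTree} (hu : IsCNF u)
    (h : Lt (left u) c) : u.toOrdinal < ω ^ c.toOrdinal := by
  induction hu with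
  | zero => exact opow_pos _ omega0_pos
  | node hs _ hst _ iht =>
    -- The leading term and the tail are both below the additively principal `ω ^ c`; for the tail,
    -- its leading exponent is at most `s`, which is below `c`.
    exact isPrincipal_add_omega0_opow _ ((opow_lt_opow_iff_right one_lt_omega0).2 (hc _ hs h))
      (iht (hst.trans_lt h))

/-- Induction on the larger form. Its exponent supplies, as induction hypothesis, exactly the bound
that `lt_opow_of_forall_lt` assumes, so a smaller leading exponent keeps all of `s` below `ω ^ c`.
-/
theorem IsCNF.toOrdinal_lt {s t : CnfTree} (hs : IsCNF s) (ht : IsCNF t) (h : Lt s t) :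
    s.toOrdinal < t.toOrdinal := by
  induction ht generalizing s with
  | zero => cases h
  | @node c d hc hd hdc ihc ihd =>
    cases hs with
    | zero => exact toOrdinal_node_pos c d
    | @node a b ha hb hba =>
      cases h with
      | left h =>
        exact (lt_opow_of_forall_lt (fun s hs => ihc hs) (.node ha hb hba) h).trans_le le_self_add
      | right h => exact add_lt_add_right (ihd hb h) _

theorem IsCNF.lt_opow {c u : CnfTree} (hc : IsCNF c) (hu : IsCNF u) (h : Lt (left u) c) :
    u.toOrdinal < ω ^ c.toOrdinal :=
  lt_opow_of_forall_lt (fun _ hs => hs.toOrdinal_lt hc) hu h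

theorem IsCNF.toOrdinal_le {s t : CnfTree} (hs : IsCNF s) (ht : IsCNF t) (h : Le s t) :
    s.toOrdinal ≤ t.toOrdinal := by
  rcases h with h | rfl
  · exact (hs.toOrdinal_lt ht h).le
  · exact le_rfl

/-- A strictly monotone map out of a total order reflects the order; totality is `le_of_not_lt`. -/
theorem IsCNF.toOrdinal_lt_iff {s t : CnfTree} (hs : IsCNF s) (ht : IsCNF t) :
    s.toOrdinal < t.toOrdinal ↔ Lt s t :=
  ⟨fun h => by_contra fun h' => h.not_ge (ht.toOrdinal_le hs (le_of_not_lt _ _ h')),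
    hs.toOrdinal_lt ht⟩

theorem IsCNF.toOrdinal_inj {s t : CnfTree} (hs : IsCNF s) (ht : IsCNF t) :
    s.toOrdinal = t.toOrdinal ↔ s = t := by
  refine ⟨fun h => ?_, fun h => h ▸ rfl⟩
  rcases le_of_not_lt s t (fun h' => (hs.toOrdinal_lt ht h').ne h) with h' | h'
  · exact absurd h (ht.toOrdinal_lt hs h').ne'
  · exact h'.symm

theorem IsCNF.toOrdinal_le_iff {s t : CnfTree} (hs : IsCNF s) (ht : IsCNF t) :
    s.toOrdinal ≤ t.toOrdinal ↔ Le s t := by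
  rw [le_iff_lt_or_eq, hs.toOrdinal_lt_iff ht, hs.toOrdinal_inj ht, Le]

-- Arithmetic of Cantor normal forms

theorem IsCNF.toOrdinal_add {s t : CnfTree} (hs : IsCNF s) (ht : IsCNF t) :
    (CnfTree.add s t).toOrdinal = s.toOrdinal + t.toOrdinal := by
  induction hs with
  | zero => simp [CnfTree.add, toOrdinal]
  | @node a c ha hc hca _ ihc =>
    cases t with
    | zero => simp [CnfTree.add, toOrdinal]
    | node b d =>
      by_cases h : Lt a b
      · have hb : IsCNF b := by cases ht; assumption
        simp only [CnfTree.add, h, if_true]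
        -- The whole left summand is below `ω ^ b`, hence absorbed by `ω ^ b + d`.
        exact (add_of_omega0_opow_le (hb.lt_opow (.node ha hc hca) h) le_self_add).symm
      · simp only [CnfTree.add, h, if_false]
        rw [toOrdinal, ihc, ← add_assoc]
        rfl

/-- The product of an ordinal in the interval from `ω ^ a` to `ω ^ (a + 1)` with a power of `ω`
whose exponent is not zero. -/
theorem mul_omega0_opow_of_lt {x a b : Ordinal} (h : ω ^ a ≤ x) (h' : x < ω ^ (a + 1))
    (hb : b ≠ 0) : x * ω ^ b = ω ^ (a + b) := by
  -- The case `b = 1`: the finite multiples of `x` stay below `ω ^ (a + 1)`, while `x` is at least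
  -- `ω ^ a`.
  have hω : x * ω = ω ^ (a + 1) := by
    refine le_antisymm ?_ ?_
    · rw [mul_le_iff_of_isSuccLimit isSuccLimit_omega0]
      exact fun n hn => (mul_lt_omega0_opow (by simp) h' hn).le
    · rw [opow_add_one]
      exact mul_le_mul_left h _
  -- The `1` is split off on the left, which is possible even for limit `b` and puts a factor `ω`
  -- next to `x`.
  obtain ⟨c, rfl⟩ : ∃ c, b = 1 + c :=
    ⟨b - 1, (Ordinal.add_sub_cancel_of_le (Order.one_le_iff_ne_zero.2 hb)).symm⟩
  rw [opow_add, opow_one, ← mul_assoc, hω, ← opow_add, add_assoc]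

/-- The upper bound that `mul_omega0_opow_of_lt` needs. The leading exponent of the tail is at most
`a`, so the leading term and the tail are both below the additively principal `ω ^ (a + 1)`. -/
theorem IsCNF.lt_opow_add_one {a c : CnfTree} (h : IsCNF (CnfTree.node a c)) :
    (CnfTree.node a c).toOrdinal < ω ^ (a.toOrdinal + 1) := by
  generalize hu : CnfTree.node a c = u at h
  induction h generalizing a c with
  | zero => cases hu
  | @node s t hs ht hst _ iht =>
    cases hu
    have hω : ω ^ s.toOrdinal < ω ^ (s.toOrdinal + 1) :=
      (opow_lt_opow_iff_right one_lt_omega0).2 (lt_add_one _)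
    refine isPrincipal_add_omega0_opow _ hω ?_
    cases ht with
    | zero => exact opow_pos _ omega0_pos
    | node hp _ _ =>
      exact (iht rfl).trans_le ((opow_le_opow_iff_right one_lt_omega0).2
        (add_le_add_left (hp.toOrdinal_le hs hst) 1))

/-- The recursion in `mul` is left distributivity over `ω ^ b + d`. For `b = 0` the first product is
`s`; otherwise only the leading exponent of `s` survives. -/
theorem IsCNF.toOrdinal_mul {s t : CnfTree} (hs : IsCNF s) (ht : IsCNF t) :
    (CnfTree.mul s t).toOrdinal = s.toOrdinal * t.toOrdinal := by
  cases s with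
  | zero => simp [CnfTree.mul, toOrdinal]
  | node a c =>
    have ha : IsCNF a := by cases hs; assumption
    induction ht with
    | zero => simp [CnfTree.mul, toOrdinal]
    | @node b d hb hd _ _ ihd =>
      by_cases h : b = CnfTree.zero
      · simp only [CnfTree.mul, h, if_true]
        rw [hs.toOrdinal_add (hs.mul hd), ihd]
        simp [toOrdinal, mul_add]
      · have hb0 : b.toOrdinal ≠ 0 := fun h0 => h ((hb.toOrdinal_inj .zero).1 h0)
        simp only [CnfTree.mul, h, if_false]
        -- Only the right factor is unfolded by `toOrdinal.eq_2 b d`; the left one stays intact to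
        -- match `mul_omega0_opow_of_lt`.
        rw [(ha.add hb).omegaPow.toOrdinal_add (hs.mul hd), ihd, toOrdinal.eq_2 b d, mul_add,
          mul_omega0_opow_of_lt (opow_le_toOrdinal_node a c) hs.lt_opow_add_one hb0, toOrdinal,
          ha.toOrdinal_add hb, toOrdinal.eq_1, add_zero]

end CnfTree

-- Transfer to `CtoB`

theorem toOrdinal_CtoB (a : Cnf) : (CtoB a).toOrdinal = a.1.toOrdinal :=
  CnfTree.toOrdinal_toBrw a.1

theorem theorem65 :
    (∀ a b : Cnf, a < b ↔ CtoB a < CtoB b) ∧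
    (∀ a b : Cnf, a ≤ b ↔ CtoB a ≤ CtoB b) ∧
    Function.Injective CtoB ∧
    (∀ a b : Cnf, CtoB (a + b) = CtoB a + CtoB b) ∧
    (∀ a b : Cnf, CtoB (a * b) = CtoB a * CtoB b) ∧
    (∀ a : Cnf, CtoB (Cnf.omegaPow a) = Brw.omega ^ CtoB a) := by
  refine ⟨fun a b => ?_, fun a b => ?_, fun a b h => ?_, fun a b => ?_, fun a b => ?_,
    -- By definition the left side is `omega ^ CtoB a + zero`.
    fun a => Brw.add_zero _⟩
  · rw [← Brw.toOrdinal_lt_iff, toOrdinal_CtoB, toOrdinal_CtoB]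
    exact (a.2.toOrdinal_lt_iff b.2).symm
  · rw [← Brw.toOrdinal_le_iff, toOrdinal_CtoB, toOrdinal_CtoB]
    exact (a.2.toOrdinal_le_iff b.2).symm
  · have h' := congrArg Brw.toOrdinal h
    rw [toOrdinal_CtoB, toOrdinal_CtoB] at h'
    exact Subtype.ext ((a.2.toOrdinal_inj b.2).1 h')
  · apply Brw.toOrdinal_injective
    rw [Brw.toOrdinal_add, toOrdinal_CtoB, toOrdinal_CtoB, toOrdinal_CtoB]
    exact a.2.toOrdinal_add b.2
  · apply Brw.toOrdinal_injective
    rw [Brw.toOrdinal_mul, toOrdinal_CtoB, toOrdinal_CtoB, toOrdinal_CtoB]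
    exact a.2.toOrdinal_mul b.2
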